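/- Let $p$ be a prime. Subgroups of a pro-$p$ group are understood to be closed, and generation is understood topologically; so for a pro-$p$ group $G$, "finitely generated" means topologically finitely generated, and $d(G)$ denotes the minimal number of topological generators. The rank gradient of a finitely generated pro-$p$ group $G$ is $$\mathrm{RG}(G)=\inf_{U\le_{\mathrm o}G}\frac{d(U)-1}{|G:U|},$$ where $U$ runs over all open subgroups of $G$. A closed subgroup $K$ of $G$ is called subnormal via finitely generated successive quotients if there is a finite chain of closed subgroups $G=K_0\trianglerighteq K_1\trianglerighteq\cdots\trianglerighteq K_s=K$, with each $K_i$ normal in $K_{i-1}$, such that each factor $K_{i-1}/K_i$ $(1\le i\le s)$ is finitely generated. Theorem. Let $G$ be a finitely generated pro-$p$ group with $\mathrm{RG}(G)>0$, and let $H$ be a finitely generated closed subgroup of $G$. Then the following are equivalent: (1) $H$ contains an infinite closed subgroup of $G$ that is subnormal in $G$ via finitely generated successive quotients; (2) $H$ contains an infinite closed normal subgroup of $G$; (3) $H$ is open in $G$. In particular, every closed subgroup $K$ of $G$ that is subnormal via finitely generated successive quotients satisfies: $K$ is finitely generated if and only if $K$ is finite or open in $G$. -/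

import Mathlib

/-- `G` is a pro-`p` group (for a prime `p`): a profinite group, i.e. a compact, totally disconnected
topological group, all of whose quotients by open normal subgroups are `p`-groups. -/
structure IsProP (p : ℕ) (G : Type*) [Group G] [TopologicalSpace G] : Prop where
  isTopologicalGroup : IsTopologicalGroup G
  compactSpace : CompactSpace G
  totallyDisconnectedSpace : TotallyDisconnectedSpace G
  isPGroup_quotient : ∀ (N : Subgroup G) [N.Normal], IsOpen (N : Set G) → IsPGroup p (G ⧸ N)

/-- `S` generates `G` topologically: the abstract subgroup generated by `S` is dense in `G`. -/
def TopGenerates {G : Type*} [Group G] [TopologicalSpace G] (S : Set G) : Prop :=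
  Dense (Subgroup.closure S : Set G)

/-- `G` is (topologically) finitely generated. For a subgroup `H` of a topological group, this is
applied to `H` with the subspace topology, for a quotient, with the quotient topology. -/
def IsTopFG (G : Type*) [Group G] [TopologicalSpace G] : Prop :=
  ∃ S : Finset G, TopGenerates (S : Set G)

/-- The minimal number `d(G)` of topological generators of a topologically finitely generated
group `G` (the value is meaningless if `G` is not topologically finitely generated). -/
noncomputable def minTopGenerators (G : Type*) [Group G] [TopologicalSpace G] : ℕ :=
  sInf {n : ℕ | ∃ S : Finset G, S.card = n ∧ TopGenerates (S : Set G)}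

/-- The (absolute) rank gradient: the infimum of `(d(U) - 1) / |G : U|` over all open subgroups `U`
of `G`. For a finitely generated profinite group `G`, every open subgroup `U` is finitely generated
and of finite index, and the family is bounded below by `-1`. -/
noncomputable def rankGradient (G : Type*) [Group G] [TopologicalSpace G] : ℝ :=
  ⨅ U : OpenSubgroup G,
    ((minTopGenerators (U : Subgroup G) : ℝ) - 1) / ((U : Subgroup G).index : ℝ)

/-- `K` is subnormal in `G` via finitely generated successive quotients: there is a chain
`G = C 0 ⊵ C 1 ⊵ ... ⊵ C s = K` of closed subgroups of `G`, each normal in the preceding one, such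
that each factor `C i / C (i + 1)` is topologically finitely generated. (The values `C i` for
`i > s` play no role.) -/
def IsSubnormalViaFG {G : Type*} [Group G] [TopologicalSpace G] (K : Subgroup G) : Prop :=
  ∃ (s : ℕ) (C : ℕ → Subgroup G), C 0 = ⊤ ∧ C s = K ∧
    (∀ i ≤ s, IsClosed (C i : Set G)) ∧
    ∀ i < s, C (i + 1) ≤ C i ∧
      ∃ _ : ((C (i + 1)).subgroupOf (C i)).Normal,
        IsTopFG (C i ⧸ (C (i + 1)).subgroupOf (C i))

/-!
The heart of the matter is that a finitely generated closed subgroup `H` containing an infinite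
closed subgroup `K` that is subnormal via finitely generated quotients is open.

Let `G = C 0 ⊵ C 1 ⊵ ... ⊵ C s = K` be the chain and let `U` be an open subgroup of `G`. By
Schreier's lemma in the factor `C i / C (i + 1)`, say generated by `n_i` elements, the group
`C i ∩ U` is generated by `C (i + 1) ∩ U` and `n_i * m_i` further elements, where `m_i` is the index
of `C (i + 1) (C i ∩ U)` in `C i`, so that `m_i * |K : K ∩ U| ≤ |G : U|`
(`Subgroup.GenByOver.inf_isOpen`). Adding these up, `U` is generated by `K ∩ U` together with at
most `D * |G : U| / |K : K ∩ U|` elements, where `D` is the sum of the `n_i`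
(`IsSubnormalViaFG.exists_genByOver_inf`). Since `K ≤ H`, the part `K ∩ U` can be replaced by
`H ∩ U`, which needs at most `|H : H ∩ U| * d(H)` generators. If `H ≤ V` and `U ≤ V` with `V` open,
this gives
`d(U) / |G : U| ≤ D / |K : K ∩ U| + d(H) / |G : V|`.
If `H` is not open, then `|G : V|` can be made arbitrarily large, and afterwards, `K` being infinite,
so can `|K : K ∩ U|` (`Subgroup.exists_isOpen_lt_relIndex`). This contradicts the positivity of the
rank gradient.

For the remaining implications, an open subgroup contains its normal core, which is infinite because
a finite group has negative rank gradient; and an infinite closed normal subgroup `N` is subnormal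
through the chain `G ⊵ N`.
-/

namespace Subgroup

/-! ### Schreier's lemma modulo a normal subgroup -/

section Algebra

variable {G : Type*} [Group G]

/-- Schreier's lemma modulo a normal subgroup `B`: it is applied in `G ⧸ B` to the image of `W`, and
the generators found there are lifted to elements of `W`. -/
theorem exists_finset_sup_closure_eq_of_normal {B W : Subgroup G} [B.Normal] [W.FiniteIndex]
    {S : Finset G} (hS : B ⊔ closure (S : Set G) = ⊤) :
    ∃ T : Finset G, T.card ≤ (B ⊔ W).index * S.card ∧ (B ⊓ W) ⊔ closure (T : Set G) = W := by
  classical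
  have hker : (QuotientGroup.mk' B).ker = B := QuotientGroup.ker_mk' B
  have hgen : closure ((S.image (QuotientGroup.mk' B) : Finset (G ⧸ B)) : Set (G ⧸ B)) = ⊤ := by
    have h := congrArg (map (QuotientGroup.mk' B)) hS
    rw [map_sup, (map_eq_bot_iff _).2 hker.ge, bot_sup_eq, MonoidHom.map_closure,
      ← MonoidHom.range_eq_map,
      MonoidHom.range_eq_top.2 (QuotientGroup.mk'_surjective B)] at h
    rw [Finset.coe_image, h]
  have hidx : (W.map (QuotientGroup.mk' B)).index = (B ⊔ W).index := by
    rw [index_map, hker, MonoidHom.range_eq_top.2 (QuotientGroup.mk'_surjective B), index_top,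
      mul_one, sup_comm]
  have : (W.map (QuotientGroup.mk' B)).FiniteIndex :=
    ⟨by rw [hidx]; exact (finiteIndex_of_le (le_sup_right : W ≤ B ⊔ W)).index_ne_zero⟩
  obtain ⟨T, hTcard, hT⟩ := exists_finset_card_le_mul (W.map (QuotientGroup.mk' B)) hgen
  have hlift : ∀ t : W.map (QuotientGroup.mk' B), ∃ w ∈ W, QuotientGroup.mk' B w = t := fun t => t.2
  choose f hfW hf using hlift
  have hTW : closure ((T.image f : Finset G) : Set G) ≤ W := by
    rw [closure_le, Finset.coe_image]
    rintro _ ⟨t, -, rfl⟩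
    exact hfW t
  refine ⟨T.image f, ?_, le_antisymm (sup_le inf_le_right hTW) fun w hw => ?_⟩
  · calc (T.image f).card ≤ T.card := Finset.card_image_le
      _ ≤ _ := hTcard
      _ ≤ _ := by rw [hidx]; exact Nat.mul_le_mul_left _ Finset.card_image_le
  · have hmap : map (QuotientGroup.mk' B) (closure ((T.image f : Finset G) : Set G)) =
        W.map (QuotientGroup.mk' B) := by
      have h := congrArg (map (W.map (QuotientGroup.mk' B)).subtype) hT
      rw [MonoidHom.map_closure, ← MonoidHom.range_eq_map, range_subtype] at h
      refine Eq.trans ?_ h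
      rw [MonoidHom.map_closure, Finset.coe_image, Set.image_image]
      congr 1
      exact Set.image_congr fun t _ => hf t
    obtain ⟨c, hc, hcw⟩ : QuotientGroup.mk' B w ∈
        map (QuotientGroup.mk' B) (closure ((T.image f : Finset G) : Set G)) :=
      hmap.ge (mem_map_of_mem _ hw)
    have hB : w * c⁻¹ ∈ B := by
      rw [← hker, MonoidHom.mem_ker, map_mul, map_inv, hcw, mul_inv_cancel]
    rw [← inv_mul_cancel_right w c]
    exact mul_mem_sup ⟨hB, W.mul_mem hw (W.inv_mem (hTW hc))⟩ hc

/-- Schreier's lemma modulo a normal subgroup `B` of a subgroup `L`. The number `m` is the index in `L`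
of `B (L ⊓ W)`; only the bound on its product with `|B : B ⊓ W|` is recorded. -/
theorem exists_finset_inf_sup_closure_eq {B L W : Subgroup G} (hBn : (B.subgroupOf L).Normal)
    (hW : W.relIndex L ≠ 0) {S : Finset G} (hS : B ⊔ closure (S : Set G) = L) :
    ∃ (m : ℕ) (T : Finset G), m * W.relIndex B ≤ W.relIndex L ∧ T.card ≤ S.card * m ∧
      (B ⊓ W) ⊔ closure (T : Set G) = L ⊓ W := by
  classical
  have hBL : B ≤ L := hS ▸ le_sup_left
  have hSL : (S : Set G) ⊆ L := fun s hs =>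
    hS ▸ (le_sup_right : closure (S : Set G) ≤ _) (subset_closure hs)
  have : (W.subgroupOf L).FiniteIndex := ⟨hW⟩
  have hinj : Function.Injective L.subtype := L.subtype_injective
  set S' : Finset L := S.preimage L.subtype hinj.injOn with hS'
  have hS'map : map L.subtype (closure (S' : Set L)) = closure (S : Set G) := by
    rw [MonoidHom.map_closure, hS', Finset.coe_preimage, Set.image_preimage_eq_inter_range]
    congr 1
    simpa using hSL
  have hgen : B.subgroupOf L ⊔ closure (S' : Set L) = ⊤ := by
    apply map_injective hinj
    rw [map_sup, hS'map, subgroupOf_map_subtype, inf_eq_left.2 hBL, hS, ← MonoidHom.range_eq_map,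
      range_subtype]
  obtain ⟨T, hTcard, hT⟩ :=
    exists_finset_sup_closure_eq_of_normal (W := W.subgroupOf L) hgen
  refine ⟨(B.subgroupOf L ⊔ W.subgroupOf L).index, T.image L.subtype, ?_, ?_, ?_⟩
  · have h1 : W.relIndex B = (W.subgroupOf L).relIndex (B.subgroupOf L) :=
      (relIndex_subgroupOf hBL).symm
    have h2 := relIndex_mul_index
      (le_sup_right : W.subgroupOf L ≤ B.subgroupOf L ⊔ W.subgroupOf L)
    change _ ≤ (W.subgroupOf L).index
    rw [← h2, h1, mul_comm]
    refine Nat.mul_le_mul_right _ (relIndex_le_of_le_right le_sup_left ?_)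
    intro h0
    rw [h0, zero_mul] at h2
    exact hW h2.symm
  · calc _ ≤ T.card := Finset.card_image_le
      _ ≤ _ := hTcard
      _ ≤ _ := by
        rw [mul_comm]
        refine Nat.mul_le_mul_right _ ?_
        rw [hS', Finset.card_preimage]
        exact Finset.card_filter_le _ _
  · have h := congrArg (map L.subtype) hT
    rw [map_sup, map_inf _ _ _ hinj, MonoidHom.map_closure, subgroupOf_map_subtype,
      subgroupOf_map_subtype, inf_eq_left.2 hBL, inf_comm W L, ← inf_assoc,
      inf_eq_left.2 hBL] at h
    rwa [Finset.coe_image]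

end Algebra

/-! ### Relative topological generation -/

section Topology

variable {G : Type*} [Group G] [TopologicalSpace G] [IsTopologicalGroup G]

/-- `A` is the closure of the subgroup generated by `B` and at most `n` further elements. All three
subgroups live in the ambient group `G`, which avoids subspace and quotient topologies; for closed
`A` and `B = ⊥` it says that `A` is topologically generated by at most `n` elements. -/
def GenByOver (B A : Subgroup G) (n : ℕ) : Prop :=
  ∃ S : Finset G, S.card ≤ n ∧ (B ⊔ closure (S : Set G)).topologicalClosure = A

namespace GenByOver

variable {A B C U : Subgroup G} {m n : ℕ}

theorem isClosed (h : GenByOver B A n) : IsClosed (A : Set G) := by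
  obtain ⟨S, -, rfl⟩ := h
  exact isClosed_topologicalClosure _

theorem le (h : GenByOver B A n) : B ≤ A := by
  obtain ⟨S, -, rfl⟩ := h
  exact le_sup_left.trans (le_topologicalClosure _)

theorem refl (hA : IsClosed (A : Set G)) : GenByOver A A 0 := by
  refine ⟨∅, le_rfl, ?_⟩
  simpa using le_antisymm (topologicalClosure_minimal _ le_rfl hA) (le_topologicalClosure _)

theorem mono_left (h : GenByOver C A n) (hCB : C ≤ B) (hBA : B ≤ A) : GenByOver B A n := by
  have hA := h.isClosed
  obtain ⟨S, hS, rfl⟩ := h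
  exact ⟨S, hS, le_antisymm (topologicalClosure_minimal _
    (sup_le hBA (le_sup_right.trans (le_topologicalClosure _))) hA)
    (topologicalClosure_mono (sup_le_sup_right hCB _))⟩

theorem trans (h : GenByOver B A n) (h' : GenByOver C B m) : GenByOver C A (n + m) := by
  classical
  have hA := h.isClosed
  have hCA := h'.le.trans h.le
  have hBA := h.le
  obtain ⟨S, hS, rfl⟩ := h
  obtain ⟨T, hT, rfl⟩ := h'
  have hle : closure (S : Set G) ≤ closure ((S ∪ T : Finset G) : Set G) :=
    closure_mono (by simp)
  have hle' : closure (T : Set G) ≤ closure ((S ∪ T : Finset G) : Set G) :=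
    closure_mono (by simp)
  refine ⟨S ∪ T, (Finset.card_union_le _ _).trans (add_le_add hS hT), le_antisymm ?_ ?_⟩
  · refine topologicalClosure_minimal _ (sup_le hCA ?_) hA
    rw [Finset.coe_union, closure_union]
    exact sup_le (le_sup_right.trans (le_topologicalClosure _))
      ((le_sup_right.trans (le_topologicalClosure _)).trans hBA)
  · refine topologicalClosure_minimal _ (sup_le (topologicalClosure_mono ?_) ?_)
      (isClosed_topologicalClosure _)
    · exact sup_le_sup_left hle' _
    · exact (hle.trans le_sup_right).trans (le_topologicalClosure _)

/-- Schreier's lemma relative to a normal subgroup, for topological generation. It is deduced from the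
algebraic version because intersecting a dense subgroup of `A` with the open subgroup `U` gives a
dense subgroup of `A ⊓ U`. -/
theorem inf_isOpen (h : GenByOver B A n) (hBn : (B.subgroupOf A).Normal)
    (hU : IsOpen (U : Set G)) (hUA : U.relIndex A ≠ 0) :
    ∃ m, m * U.relIndex B ≤ U.relIndex A ∧ GenByOver (B ⊓ U) (A ⊓ U) (n * m) := by
  have hA := h.isClosed
  obtain ⟨S, hS, hSA⟩ := h
  have hLA : B ⊔ closure (S : Set G) ≤ A := hSA ▸ le_topologicalClosure _
  have hBL : B ≤ B ⊔ closure (S : Set G) := le_sup_left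
  have hLn : (B.subgroupOf (B ⊔ closure (S : Set G))).Normal :=
    (normal_subgroupOf_iff hBL).2 fun b x hb hx =>
      (normal_subgroupOf_iff (hBL.trans hLA)).1 hBn b x hb (hLA hx)
  have hUL : U.relIndex (B ⊔ closure (S : Set G)) ≤ U.relIndex A :=
    relIndex_le_of_le_right hLA hUA
  obtain ⟨m, T, hm, hT, hTL⟩ := exists_finset_inf_sup_closure_eq hLn
    (fun h0 => hUA (relIndex_eq_zero_of_le_right hLA h0)) rfl
  refine ⟨m, hm.trans hUL, T, hT.trans (Nat.mul_le_mul_right _ hS), ?_⟩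
  rw [hTL]
  refine le_antisymm (topologicalClosure_minimal _ (inf_le_inf_right _ hLA) ?_) ?_
  · exact hA.inter (U.isClosed_of_isOpen hU)
  · rintro x ⟨hxA, hxU⟩
    rw [← hSA] at hxA
    have := hU.inter_closure ⟨hxU, hxA⟩
    rw [Set.inter_comm] at this
    exact this

end GenByOver

theorem genByOver_bot_iff {A : Subgroup G} (hA : IsClosed (A : Set G)) {n : ℕ} :
    GenByOver ⊥ A n ↔ ∃ S : Finset A, S.card ≤ n ∧ TopGenerates (S : Set A) := by
  classical
  constructor
  · rintro ⟨S, hS, hSA⟩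
    rw [bot_sup_eq] at hSA
    have hSub : (S : Set G) ⊆ A := fun s hs =>
      hSA ▸ le_topologicalClosure (closure (S : Set G)) (subset_closure hs)
    refine ⟨S.preimage A.subtype A.subtype_injective.injOn, ?_, ?_⟩
    · rw [Finset.card_preimage]
      exact (Finset.card_filter_le _ _).trans hS
    · have hmap : map A.subtype (closure
          ((S.preimage A.subtype A.subtype_injective.injOn : Finset A) : Set A)) =
          closure (S : Set G) := by
        rw [MonoidHom.map_closure, Finset.coe_preimage, Set.image_preimage_eq_inter_range]
        congr 1
        simpa using hSub
      intro x
      rw [closure_subtype]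
      change (x : G) ∈ _root_.closure ((map A.subtype _ : Subgroup G) : Set G)
      rw [hmap]
      exact hSA.ge x.2
  · rintro ⟨S, hS, hSA⟩
    refine ⟨S.image A.subtype, Finset.card_image_le.trans hS, ?_⟩
    rw [bot_sup_eq, Finset.coe_image, ← MonoidHom.map_closure]
    refine le_antisymm (topologicalClosure_minimal _ (map_subtype_le _) hA) fun x hx => ?_
    have := hSA ⟨x, hx⟩
    rw [closure_subtype] at this
    exact this

theorem genByOver_of_isTopFG_quotient {A B : Subgroup G} (hA : IsClosed (A : Set G)) (hBA : B ≤ A)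
    [(B.subgroupOf A).Normal] (h : IsTopFG (A ⧸ B.subgroupOf A)) : ∃ n, GenByOver B A n := by
  classical
  obtain ⟨S, hS⟩ := h
  have hmap : map (QuotientGroup.mk' (B.subgroupOf A))
      (closure ((S.image Quotient.out : Finset A) : Set A)) = closure (S : Set _) := by
    rw [MonoidHom.map_closure, Finset.coe_image, Set.image_image]
    congr 1
    simp
  have hdense : Dense ((B.subgroupOf A ⊔ closure ((S.image Quotient.out : Finset A) : Set A) :
      Subgroup A) : Set A) := by
    have := Dense.preimage hS (QuotientGroup.isOpenMap_coe (N := B.subgroupOf A))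
    rw [← hmap] at this
    rw [sup_comm]
    convert this
    have h := comap_map_eq (QuotientGroup.mk' (B.subgroupOf A))
      (closure ((S.image Quotient.out : Finset A) : Set A))
    rw [QuotientGroup.ker_mk'] at h
    rw [← h]
    rfl
  refine ⟨_, (S.image Quotient.out : Finset A).image A.subtype, le_rfl, ?_⟩
  have himage : B ⊔ closure (((S.image Quotient.out : Finset A).image A.subtype : Finset G) : Set G)
      = map A.subtype
        (B.subgroupOf A ⊔ closure ((S.image Quotient.out : Finset A) : Set A)) := by
    rw [map_sup, subgroupOf_map_subtype, inf_eq_left.2 hBA, MonoidHom.map_closure]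
    simp only [Finset.coe_image]
  rw [himage]
  refine le_antisymm (topologicalClosure_minimal _ (map_subtype_le _) hA) fun x hx => ?_
  have := hdense ⟨x, hx⟩
  rw [closure_subtype] at this
  exact this

end Topology

/-! ### Open subgroups of large index in profinite groups -/

section Profinite

variable {G : Type*} [Group G] [TopologicalSpace G] [IsTopologicalGroup G] [CompactSpace G]

theorem finiteIndex_of_isOpen_of_compactSpace {U : Subgroup G} (hU : IsOpen (U : Set G)) :
    U.FiniteIndex := by
  have := U.quotient_finite_of_isOpen hU
  exact finiteIndex_of_finite_quotient

theorem relIndex_ne_zero_of_isOpen {U : Subgroup G} (hU : IsOpen (U : Set G)) (A : Subgroup G) :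
    U.relIndex A ≠ 0 := fun h =>
  (finiteIndex_of_isOpen_of_compactSpace hU).index_ne_zero (index_eq_zero_of_relIndex_eq_zero h)

/-- If no open subgroup `W ≥ L` meets `A` inside the closed subgroup `L`, then the indices
`|A : A ⊓ W|` are unbounded: otherwise a `W` of maximal index would satisfy `A ⊓ W ≤ V` for every
open `V ≥ L`, and `L` is the intersection of these `V`. -/
theorem exists_isOpen_lt_relIndex [TotallyDisconnectedSpace G] {A L : Subgroup G}
    (hL : IsClosed (L : Set G))
    (hne : ∀ W : Subgroup G, IsOpen (W : Set G) → L ≤ W → ¬ A ⊓ W ≤ L) (M : ℕ) :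
    ∃ W : Subgroup G, IsOpen (W : Set G) ∧ L ≤ W ∧ M < W.relIndex A := by
  by_contra! hM
  let P : ℕ → Prop := fun n => ∃ W : Subgroup G, IsOpen (W : Set G) ∧ L ≤ W ∧ W.relIndex A = n
  have hP : ∃ n, P n := ⟨_, ⊤, isOpen_univ, le_top, rfl⟩
  obtain ⟨n, ⟨W, hW, hLW, rfl⟩, hmax⟩ : ∃ n, P n ∧ ∀ k, P k → k ≤ n := by
    classical
    obtain ⟨n, hn⟩ := hP
    have hb : ∀ k, P k → k ≤ M := by
      rintro k ⟨W, hW, hLW, rfl⟩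
      exact hM W hW hLW
    exact ⟨Nat.findGreatest P M, Nat.findGreatest_spec (hb n hn) hn,
      fun k hk => Nat.le_findGreatest (hb k hk) hk⟩
  refine hne W hW hLW ?_
  have hL' : L = sInf {N : Subgroup G | IsOpen (N : Set G) ∧ L ≤ N} :=
    ProfiniteGrp.closedSubgroup_eq_sInf_open ⟨L, hL⟩
  rw [hL']
  refine le_sInf fun V hV => ?_
  have hWV : IsOpen ((W ⊓ V : Subgroup G) : Set G) := hW.inter hV.1
  have h1 := hmax _ ⟨W ⊓ V, hWV, le_inf hLW hV.2, rfl⟩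
  have h2 := relIndex_inf_mul_relIndex V W A
  rw [inf_comm] at h1
  have h3 : V.relIndex (W ⊓ A) = 1 := by
    have h4 := relIndex_ne_zero_of_isOpen hV.1 (W ⊓ A)
    have h5 := relIndex_ne_zero_of_isOpen hW A
    have h6 : V.relIndex (W ⊓ A) * W.relIndex A ≤ 1 * W.relIndex A := by rw [h2, one_mul]; exact h1
    have := Nat.le_of_mul_le_mul_right h6 (Nat.pos_of_ne_zero h5)
    omega
  rw [inf_comm]
  exact relIndex_eq_one.1 h3

theorem exists_isOpen_lt_index [TotallyDisconnectedSpace G] {H : Subgroup G}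
    (hH : IsClosed (H : Set G)) (hHo : ¬ IsOpen (H : Set G)) (M : ℕ) :
    ∃ V : Subgroup G, IsOpen (V : Set G) ∧ H ≤ V ∧ M < V.index := by
  obtain ⟨V, hV, hHV, hM⟩ := exists_isOpen_lt_relIndex (A := ⊤) hH
    (fun W hW _ h => hHo (isOpen_mono (by simpa using h) hW)) M
  exact ⟨V, hV, hHV, by simpa using hM⟩

theorem exists_isOpen_le_lt_relIndex [TotallyDisconnectedSpace G] (K : Subgroup G) [Infinite K]
    {V : Subgroup G} (hV : IsOpen (V : Set G)) (M : ℕ) :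
    ∃ U : Subgroup G, IsOpen (U : Set G) ∧ U ≤ V ∧ M < U.relIndex K := by
  obtain ⟨W, hW, -, hM⟩ := exists_isOpen_lt_relIndex (A := K) (L := ⊥)
    (by simp) (fun W hW _ h => by
      have h0 := relIndex_ne_zero_of_isOpen hW K
      rw [← inf_relIndex_left, le_bot_iff.1 h, relIndex_bot_left] at h0
      exact h0 Nat.card_eq_zero_of_infinite) M
  refine ⟨W ⊓ V, hW.inter hV, inf_le_right, hM.trans_le ?_⟩
  exact relIndex_le_of_le_left inf_le_left (relIndex_ne_zero_of_isOpen (hW.inter hV) K)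

end Profinite

end Subgroup

open Subgroup

/-! ### Topological generation and the rank gradient -/

section RankGradient

variable {G : Type*} [Group G] [TopologicalSpace G]

theorem IsTopFG.of_denseRange {A B : Type*} [Group A] [TopologicalSpace A] [Group B]
    [TopologicalSpace B] (h : IsTopFG A) (f : A →* B) (hf : Continuous f) (hd : DenseRange f) :
    IsTopFG B := by
  classical
  obtain ⟨S, hS⟩ := h
  refine ⟨S.image f, ?_⟩
  have h : Dense (f '' (Subgroup.closure (S : Set A) : Set A)) := hd.dense_image hf hS
  rwa [← coe_map, MonoidHom.map_closure, ← Finset.coe_image] at h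

theorem IsTopFG.subgroup_top (h : IsTopFG G) : IsTopFG (⊤ : Subgroup G) :=
  h.of_denseRange (topEquiv.symm : G ≃* (⊤ : Subgroup G)).toMonoidHom
    (continuous_id.subtype_mk _) (topEquiv.symm : G ≃* (⊤ : Subgroup G)).surjective.denseRange

theorem isSubnormalViaFG_of_normal (hfg : IsTopFG G) {N : Subgroup G} [N.Normal]
    (hN : IsClosed (N : Set G)) : IsSubnormalViaFG N := by
  refine ⟨1, fun i => Nat.rec ⊤ (fun _ _ => N) i, rfl, rfl, ?_, ?_⟩
  · intro i _
    cases i with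
    | zero => exact isClosed_univ
    | succ i => exact hN
  · intro i hi
    obtain rfl : i = 0 := by omega
    refine ⟨le_top, inferInstanceAs (N.subgroupOf ⊤).Normal, ?_⟩
    exact hfg.subgroup_top.of_denseRange (QuotientGroup.mk' (N.subgroupOf ⊤))
      QuotientGroup.continuous_mk (QuotientGroup.mk'_surjective _).denseRange

theorem rankGradient_le {U : Subgroup G} (hU : IsOpen (U : Set G)) :
    rankGradient G ≤ ((minTopGenerators U : ℝ) - 1) / (U.index : ℝ) := by
  refine ciInf_le (f := fun U : OpenSubgroup G =>
    ((minTopGenerators (U : Subgroup G) : ℝ) - 1) / ((U : Subgroup G).index : ℝ))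
    ⟨-1, ?_⟩ (⟨U, hU⟩ : OpenSubgroup G)
  -- The term is `0` if the index of `V` is infinite (index `0`), and at least `-1` otherwise.
  rintro _ ⟨V, rfl⟩
  have h0 : (0 : ℝ) ≤ minTopGenerators (V : Subgroup G) := Nat.cast_nonneg _
  rcases Nat.eq_zero_or_pos (V : Subgroup G).index with h | h
  · simp [h]
  · have h1 : (1 : ℝ) ≤ ((V : Subgroup G).index : ℝ) := by exact_mod_cast h
    simp only
    rw [le_div_iff₀ (by linarith)]
    linarith

variable [IsTopologicalGroup G]

theorem IsTopFG.exists_genByOver_bot {A : Subgroup G} (hA : IsClosed (A : Set G))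
    (h : IsTopFG A) : ∃ n, GenByOver ⊥ A n := by
  obtain ⟨S, hS⟩ := h
  exact ⟨_, (genByOver_bot_iff hA).2 ⟨S, le_rfl, hS⟩⟩

theorem Subgroup.GenByOver.isTopFG {A : Subgroup G} {n : ℕ} (h : GenByOver ⊥ A n) : IsTopFG A := by
  obtain ⟨S, -, hS⟩ := (genByOver_bot_iff h.isClosed).1 h
  exact ⟨S, hS⟩

theorem Subgroup.GenByOver.minTopGenerators_le {A : Subgroup G} {n : ℕ} (h : GenByOver ⊥ A n) :
    minTopGenerators A ≤ n := by
  obtain ⟨S, hn, hS⟩ := (genByOver_bot_iff h.isClosed).1 h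
  have hmem : S.card ∈ {k : ℕ | ∃ S : Finset A, S.card = k ∧ TopGenerates (S : Set A)} :=
    ⟨S, rfl, hS⟩
  exact (Nat.sInf_le hmem).trans hn

/-- In a finite group the trivial subgroup is open and contributes `(0 - 1) / |G| < 0`. -/
theorem infinite_of_rankGradient_pos [T1Space G] (h : 0 < rankGradient G) : Infinite G := by
  by_contra hfin
  rw [not_infinite_iff_finite] at hfin
  have hbot : IsOpen ((⊥ : Subgroup G) : Set G) := isOpen_discrete _
  have hgen : GenByOver (⊥ : Subgroup G) ⊥ 0 := .refl (by simp)
  have h0 : minTopGenerators (⊥ : Subgroup G) = 0 := Nat.le_zero.1 hgen.minTopGenerators_le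
  have h1 := h.trans_le (rankGradient_le hbot)
  rw [h0, index_bot] at h1
  have h2 : (0 : ℝ) < Nat.card G := by exact_mod_cast Nat.card_pos
  have h3 : ((0 : ℕ) - 1 : ℝ) / Nat.card G < 0 := div_neg_of_neg_of_pos (by norm_num) h2
  linarith

/-! ### Subgroups containing an infinite subnormal subgroup -/

variable [CompactSpace G]

theorem IsTopFG.of_isOpen (hfg : IsTopFG G) {U : Subgroup G} (hU : IsOpen (U : Set G)) :
    IsTopFG U := by
  obtain ⟨n, hn⟩ := hfg.subgroup_top.exists_genByOver_bot isClosed_univ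
  obtain ⟨m, -, hm⟩ := hn.inf_isOpen inferInstance hU (relIndex_ne_zero_of_isOpen hU _)
  rw [top_inf_eq, bot_inf_eq] at hm
  exact hm.isTopFG

/-- An open subgroup `U` is generated over `K ⊓ U` by at most `D * |G : U| / |K : K ⊓ U|` elements,
where `D` depends only on the chain from `G` to `K`. -/
theorem IsSubnormalViaFG.exists_genByOver_inf {K : Subgroup G} (hK : IsSubnormalViaFG K) :
    ∃ D : ℕ, ∀ U : Subgroup G, IsOpen (U : Set G) →
      ∃ m, m * U.relIndex K ≤ D * U.index ∧ GenByOver (K ⊓ U) U m := by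
  obtain ⟨s, C, h0, rfl, hcl, hstep⟩ := hK
  suffices ∀ j ≤ s, ∃ D : ℕ, ∀ U : Subgroup G, IsOpen (U : Set G) →
      ∃ m, m * U.relIndex (C j) ≤ D * U.index ∧ GenByOver (C j ⊓ U) U m from this s le_rfl
  intro j
  induction j with
  | zero =>
    refine fun _ => ⟨0, fun U hU => ⟨0, by simp, ?_⟩⟩
    rw [h0, top_inf_eq]
    exact .refl (U.isClosed_of_isOpen hU)
  | succ j ih =>
    intro hj
    obtain ⟨D, hD⟩ := ih (by omega)
    obtain ⟨hle, hn, hq⟩ := hstep j (by omega)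
    obtain ⟨n, hgen⟩ := genByOver_of_isTopFG_quotient (hcl j (by omega)) hle hq
    refine ⟨D + n, fun U hU => ?_⟩
    obtain ⟨m, hm, hmU⟩ := hD U hU
    obtain ⟨k, hk, hkU⟩ := hgen.inf_isOpen hn hU (relIndex_ne_zero_of_isOpen hU _)
    refine ⟨m + n * k, ?_, hmU.trans hkU⟩
    have h1 : U.relIndex (C (j + 1)) ≤ U.relIndex (C j) :=
      relIndex_le_of_le_right hle (relIndex_ne_zero_of_isOpen hU _)
    have h2 : U.relIndex (C j) ≤ U.index := by
      rw [← relIndex_top_right]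
      exact relIndex_le_of_le_right le_top (relIndex_ne_zero_of_isOpen hU _)
    calc (m + n * k) * U.relIndex (C (j + 1))
        = m * U.relIndex (C (j + 1)) + n * (k * U.relIndex (C (j + 1))) := by ring
      _ ≤ m * U.relIndex (C j) + n * U.relIndex (C j) := by gcongr
      _ ≤ D * U.index + n * U.index := by gcongr
      _ = (D + n) * U.index := by ring

/-- The key step. For `U ≤ V` open with `H ≤ V`, the bound
`d(U) / |G : U| ≤ D / |K : K ⊓ U| + d(H) / |G : V|` becomes smaller than the rank gradient when both
denominators on the right are large. -/
theorem isOpen_of_isSubnormalViaFG_le [TotallyDisconnectedSpace G] (hRG : 0 < rankGradient G)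
    {H K : Subgroup G} (hH : IsClosed (H : Set G)) (hHfg : IsTopFG H) (hKH : K ≤ H) [Infinite K]
    (hK : IsSubnormalViaFG K) : IsOpen (H : Set G) := by
  by_contra hHo
  obtain ⟨d, hd⟩ := hHfg.exists_genByOver_bot hH
  obtain ⟨D, hD⟩ := hK.exists_genByOver_inf
  -- `(d + D) / M` will bound the rank gradient once both indices exceed `M`.
  obtain ⟨M, hM⟩ := exists_nat_gt ((d + D) / rankGradient G)
  rw [div_lt_iff₀ hRG] at hM
  obtain ⟨V, hV, hHV, hMV⟩ := exists_isOpen_lt_index hH hHo M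
  obtain ⟨U, hU, hUV, hMU⟩ := exists_isOpen_le_lt_relIndex K hV M
  obtain ⟨m, hm, hmU⟩ := hD U hU
  obtain ⟨k, hk, hkU⟩ := hd.inf_isOpen inferInstance hU (relIndex_ne_zero_of_isOpen hU _)
  rw [relIndex_bot_right, mul_one] at hk
  rw [bot_inf_eq] at hkU
  have hgen : GenByOver ⊥ U (m + d * k) :=
    (hmU.mono_left (inf_le_inf_right _ hKH) inf_le_right).trans hkU
  have hkV : k ≤ U.relIndex V :=
    hk.trans (relIndex_le_of_le_right hHV (relIndex_ne_zero_of_isOpen hU _))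
  have hidx := relIndex_mul_index hUV
  have hpos : 0 < U.index :=
    Nat.pos_of_ne_zero (finiteIndex_of_isOpen_of_compactSpace hU).index_ne_zero
  -- Both contributions to `d(U)` are small compared with `|G : U|`.
  have h1 : m * M ≤ D * U.index := (Nat.mul_le_mul_left _ hMU.le).trans hm
  have h2 : k * M ≤ U.index := hidx ▸ Nat.mul_le_mul hkV hMV.le
  have h3 : (m + d * k) * M ≤ (D + d) * U.index := by
    calc (m + d * k) * M = m * M + d * (k * M) := by ring
      _ ≤ D * U.index + d * U.index := by gcongr
      _ = (D + d) * U.index := by ring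
  have hposR : (0 : ℝ) < U.index := by exact_mod_cast hpos
  have h4 : rankGradient G * U.index ≤ m + d * k := by
    have h5 := rankGradient_le hU
    rw [le_div_iff₀ hposR] at h5
    have h6 : (minTopGenerators U : ℝ) ≤ m + d * k := by exact_mod_cast hgen.minTopGenerators_le
    linarith
  have h7 : ((m : ℝ) + d * k) * M ≤ (D + d) * U.index := by exact_mod_cast h3
  have h8 : rankGradient G * U.index * M ≤ (D + d) * U.index :=
    (mul_le_mul_of_nonneg_right h4 (Nat.cast_nonneg M)).trans h7
  have h9 : M * rankGradient G ≤ D + d := by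
    refine le_of_mul_le_mul_right ?_ hposR
    linarith
  linarith

end RankGradient

theorem theorem1p1 (p : ℕ) (hp : p.Prime) (G : Type*) [Group G] [TopologicalSpace G]
    (hG : IsProP p G) (hfg : IsTopFG G) (hRG : 0 < rankGradient G) :
    (∀ H : Subgroup G, IsClosed (H : Set G) → IsTopFG H →
      List.TFAE [
        ∃ K : Subgroup G, K ≤ H ∧ IsClosed (K : Set G) ∧ Infinite K ∧ IsSubnormalViaFG K,
        ∃ N : Subgroup G, N ≤ H ∧ IsClosed (N : Set G) ∧ Infinite N ∧ N.Normal,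
        IsOpen (H : Set G)]) ∧
    (∀ K : Subgroup G, IsClosed (K : Set G) → IsSubnormalViaFG K →
      (IsTopFG K ↔ (Finite K ∨ IsOpen (K : Set G)))) := by
  have := hG.isTopologicalGroup
  have := hG.compactSpace
  have := hG.totallyDisconnectedSpace
  refine ⟨fun H hH hHfg => ?_, fun K hK hKs => ⟨fun hKfg => ?_, ?_⟩⟩
  · tfae_have 1 → 3 := by
      rintro ⟨K, hKH, -, hKinf, hKs⟩
      exact isOpen_of_isSubnormalViaFG_le hRG hH hHfg hKH hKs
    tfae_have 3 → 2 := by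
      intro hHo
      have := infinite_of_rankGradient_pos hRG
      have := finiteIndex_of_isOpen_of_compactSpace hHo
      refine ⟨H.normalCore, H.normalCore_le, H.normalCore_isClosed hH, ?_, H.normalCore_normal⟩
      by_contra hfin
      rw [not_infinite_iff_finite] at hfin
      refine not_finite_iff_infinite.2 ‹Infinite G› (Nat.finite_of_card_ne_zero ?_)
      rw [← H.normalCore.card_mul_index]
      exact mul_ne_zero Nat.card_pos.ne' FiniteIndex.index_ne_zero
    tfae_have 2 → 1 := by
      rintro ⟨N, hNH, hN, hNinf, hNn⟩
      exact ⟨N, hNH, hN, hNinf, isSubnormalViaFG_of_normal hfg hN⟩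
    tfae_finish
  · rcases finite_or_infinite K with hfin | hinf
    · exact .inl hfin
    · exact .inr (isOpen_of_isSubnormalViaFG_le hRG hK hKfg le_rfl hKs)
  · rintro (hfin | hopen)
    · have := Fintype.ofFinite K
      refine ⟨Finset.univ, ?_⟩
      simp [TopGenerates]
    · exact hfg.of_isOpen hopen
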